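/- Let $n\ge 1$ and let $M$ be a (non-empty) smooth manifold of dimension $2n+1$ with a Riemannian metric $g$ and Levi-Civita connection $\nabla$. Let $\varphi$ be a smooth $(1,1)$-tensor field, $\xi$ a smooth vector field and $\eta$ a smooth $1$-form on $M$ such that $$\varphi^2=-I+\eta\otimes\xi,\qquad \eta(\xi)=1,\qquad g(\varphi X,\varphi Y)=g(X,Y)-\eta(X)\eta(Y),$$ and suppose that $(M,\varphi,\xi,\eta,g)$ is a Kenmotsu manifold, that is, $$(\nabla_X\varphi)Y=g(\varphi X,Y)\,\xi-\eta(Y)\,\varphi X$$ for all vector fields $X,Y$. Put $R(X,Y)=[\nabla_X,\nabla_Y]-\nabla_{[X,Y]}$ and let $$S^*(X,Y)=\tfrac12\operatorname{trace}\bigl(Z\mapsto R(X,\varphi Y)\varphi Z\bigr)$$ be the $*$-Ricci tensor. If $V$ is a smooth vector field and $\lambda\in\mathbb R$ is a constant such that $g$ is a $*$-Ricci soliton, $$\pounds_V g+2S^*+2\lambda g=0,$$ then $\lambda=0$. -/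

import Mathlib

open Bundle FiberBundle VectorField
open scoped Manifold ContDiff

noncomputable section

namespace StarRicci

section Defs

variable {E : Type*} [NormedAddCommGroup E] [NormedSpace ℝ E]
  {H : Type*} [TopologicalSpace H] {I : ModelWithCorners ℝ E H}
  {M : Type*} [TopologicalSpace M] [ChartedSpace H M]
  [RiemannianBundle (fun x : M ↦ TangentSpace I x)]

/-- The right-hand side of the Koszul formula for `2 g(∇_X Y, Z)`:
`X g(Y,Z) + Y g(X,Z) - Z g(X,Y) + g([X,Y],Z) - g([X,Z],Y) - g([Y,Z],X)`. -/
def koszul (X Y Z : Π x : M, TangentSpace I x) (x : M) : ℝ :=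
  mvfderiv I (fun y ↦ inner ℝ (Y y) (Z y)) x (X x)
    + mvfderiv I (fun y ↦ inner ℝ (X y) (Z y)) x (Y x)
    - mvfderiv I (fun y ↦ inner ℝ (X y) (Y y)) x (Z x)
    + inner ℝ (mlieBracket I X Y x) (Z x)
    - inner ℝ (mlieBracket I X Z x) (Y x)
    - inner ℝ (mlieBracket I Y Z x) (X x)

/-- The Lie derivative of the metric,
`(£_V g)(X,Y) = V g(X,Y) - g([V,X],Y) - g(X,[V,Y])`. -/
def lieDerivMetric (V X Y : Π x : M, TangentSpace I x) (x : M) : ℝ :=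
  mvfderiv I (fun y ↦ inner ℝ (X y) (Y y)) x (V x)
    - inner ℝ (mlieBracket I V X x) (Y x) - inner ℝ (X x) (mlieBracket I V Y x)

/-- Two tangent vectors at `x` agree if they have the same inner products with the values at `x` of
all vector fields that are differentiable at `x`. -/
theorem ext_inner_field [IsManifold I 1 M] {x : M} {u v : TangentSpace I x}
    (h : ∀ Z : Π x : M, TangentSpace I x, MDiffAt (T% Z) x →
      inner ℝ u (Z x) = inner ℝ v (Z x)) : u = v := by
  refine ext_inner_right ℝ fun w ↦ ?_
  simpa using h (extend E w) (mdifferentiableAt_extend ..)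

theorem mdiffAt_inner [IsManifold I 1 M]
    [IsContMDiffRiemannianBundle I 1 E (fun x : M ↦ TangentSpace I x)]
    {X Y : Π x : M, TangentSpace I x} {x : M} (hX : MDiffAt (T% X) x) (hY : MDiffAt (T% Y) x) :
    MDiffAt (fun y ↦ (inner ℝ (X y) (Y y) : ℝ)) x :=
  MDifferentiableAt.inner_bundle (E := fun x : M ↦ TangentSpace I x) (F := E) hX hY

variable [FiniteDimensional ℝ E] [IsManifold I ∞ M]
  [IsContMDiffRiemannianBundle I ∞ E (fun x : M ↦ TangentSpace I x)]

theorem koszul_tensorial_left {x : M} {Y Z : Π x : M, TangentSpace I x}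
    (hY : MDiffAt (T% Y) x) (hZ : MDiffAt (T% Z) x) :
    TensorialAt I E (koszul · Y Z x) x where
  smul {f X} hf hX := by
    have : CompleteSpace E := FiniteDimensional.complete ℝ E
    simp [koszul, mvfderiv_fun_mul hf (mdiffAt_inner hX hZ),
      mvfderiv_fun_mul hf (mdiffAt_inner hX hY), mlieBracket_smul_left hf hX,
      inner_add_left, inner_smul_left, inner_smul_right]
    ring
  add {X X'} hX hX' := by
    have : CompleteSpace E := FiniteDimensional.complete ℝ E
    simp [koszul, mvfderiv_fun_add (mdiffAt_inner hX hZ) (mdiffAt_inner hX' hZ),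
      mvfderiv_fun_add (mdiffAt_inner hX hY) (mdiffAt_inner hX' hY),
      mlieBracket_add_left hX hX', inner_add_left, inner_add_right]
    ring

theorem koszul_tensorial_right {x : M} {X Y : Π x : M, TangentSpace I x}
    (hX : MDiffAt (T% X) x) (hY : MDiffAt (T% Y) x) :
    TensorialAt I E (koszul X Y · x) x where
  smul {f Z} hf hZ := by
    have : CompleteSpace E := FiniteDimensional.complete ℝ E
    simp [koszul, mvfderiv_fun_mul hf (mdiffAt_inner hX hZ),
      mvfderiv_fun_mul hf (mdiffAt_inner hY hZ), mlieBracket_smul_right hf hZ,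
      inner_add_left, inner_smul_left, inner_smul_right]
    rw [real_inner_comm (X x) (Z x), real_inner_comm (Y x) (Z x)]
    ring
  add {Z Z'} hZ hZ' := by
    have : CompleteSpace E := FiniteDimensional.complete ℝ E
    simp [koszul, mvfderiv_fun_add (mdiffAt_inner hX hZ) (mdiffAt_inner hX hZ'),
      mvfderiv_fun_add (mdiffAt_inner hY hZ) (mdiffAt_inner hY hZ'),
      mlieBracket_add_right hZ hZ', inner_add_left, inner_add_right]
    ring

instance (x : M) : FiniteDimensional ℝ (TangentSpace I x) :=
  inferInstanceAs (FiniteDimensional ℝ E)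

open scoped Classical in
/-- `v ↦ ∇_v Y` at `x`: the vector `∇_v Y` is the one with `2 g(∇_v Y, w) = koszul v Y w` for all
`w`, written in an orthonormal basis of the tangent space (and `0` if `Y` is not differentiable at
`x`). -/
def leviCivitaFun (Y : Π x : M, TangentSpace I x) (x : M) :
    TangentSpace I x →L[ℝ] TangentSpace I x :=
  if hY : MDiffAt (T% Y) x then
    (1 / 2 : ℝ) • ∑ i,
      ((TensorialAt.mkHom₂ (I := I) (F := E) (F' := E) (koszul · Y · x) x
          (fun _ hZ ↦ koszul_tensorial_left hY hZ)
          (fun _ hX ↦ koszul_tensorial_right hX hY)).flip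
        (stdOrthonormalBasis ℝ (TangentSpace I x) i)).smulRight
          (stdOrthonormalBasis ℝ (TangentSpace I x) i)
  else 0

theorem inner_leviCivitaFun {X Y Z : Π x : M, TangentSpace I x} {x : M}
    (hX : MDiffAt (T% X) x) (hY : MDiffAt (T% Y) x) (hZ : MDiffAt (T% Z) x) :
    inner ℝ (leviCivitaFun Y x (X x)) (Z x) = 1 / 2 * koszul X Y Z x := by
  classical
  rw [leviCivitaFun, dif_pos hY]
  have key := TensorialAt.mkHom₂_apply (I := I) (F := E) (F' := E) (Φ := (koszul · Y · x)) (x := x)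
    (fun _ hZ ↦ koszul_tensorial_left hY hZ) (fun _ hX ↦ koszul_tensorial_right hX hY) hX hZ
  rw [← key]
  generalize TensorialAt.mkHom₂ (I := I) (F := E) (F' := E) (koszul · Y · x) x
    (fun _ hZ ↦ koszul_tensorial_left hY hZ) (fun _ hX ↦ koszul_tensorial_right hX hY) = A
  have hb := (stdOrthonormalBasis ℝ (TangentSpace I x)).sum_repr' (Z x)
  conv_rhs => rw [← hb]
  simp [sum_inner, inner_smul_left, mul_comm]

variable (I M) in
/-- The Levi-Civita connection of the Riemannian metric, as a covariant derivative on the tangent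
bundle: `leviCivita I M Y x v` is `(∇_v Y)(x)`. -/
def leviCivita : CovariantDerivative I E (TangentSpace I : M → Type _) where
  toFun := leviCivitaFun
  isCovariantDerivativeOnUniv :=
    { add := by
        intro Y Y' x hY hY' _
        have : CompleteSpace E := FiniteDimensional.complete ℝ E
        ext v
        refine ext_inner_field fun Z hZ ↦ ?_
        have hX : MDiffAt (T% (extend E v : Π x : M, TangentSpace I x)) x :=
          mdifferentiableAt_extend ..
        have e (W : Π x : M, TangentSpace I x) (hW : MDiffAt (T% W) x) :
            inner ℝ (leviCivitaFun W x v) (Z x) = 1 / 2 * koszul (extend E v) W Z x := by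
          simpa using inner_leviCivitaFun hX hW hZ
        rw [e _ (mdifferentiableAt_add_section hY hY')]
        simp only [add_apply, inner_add_left]
        rw [e _ hY, e _ hY']
        simp [koszul, mvfderiv_fun_add (mdiffAt_inner hY hZ) (mdiffAt_inner hY' hZ),
          mvfderiv_fun_add (mdiffAt_inner hX hY) (mdiffAt_inner hX hY'),
          mlieBracket_add_left hY hY', mlieBracket_add_right hY hY', inner_add_left,
          inner_add_right]
        ring
      leibniz := by
        intro Y f x hY hf _
        have : CompleteSpace E := FiniteDimensional.complete ℝ E
        ext v
        refine ext_inner_field fun Z hZ ↦ ?_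
        have hX : MDiffAt (T% (extend E v : Π x : M, TangentSpace I x)) x :=
          mdifferentiableAt_extend ..
        have e (W : Π x : M, TangentSpace I x) (hW : MDiffAt (T% W) x) :
            inner ℝ (leviCivitaFun W x v) (Z x) = 1 / 2 * koszul (extend E v) W Z x := by
          simpa using inner_leviCivitaFun hX hW hZ
        rw [e _ (hf.smul_section hY)]
        simp only [add_apply, inner_add_left, smul_apply, inner_smul_left]
        rw [e _ hY]
        simp [koszul, mvfderiv_fun_mul hf (mdiffAt_inner hY hZ),
          mvfderiv_fun_mul hf (mdiffAt_inner hX hY), mlieBracket_smul_left hf hY,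
          mlieBracket_smul_right hf hY, inner_add_left, inner_smul_left, inner_smul_right]
        rw [real_inner_comm v (Y x)]
        ring }

theorem inner_leviCivita {X Y Z : Π x : M, TangentSpace I x} {x : M}
    (hX : MDiffAt (T% X) x) (hY : MDiffAt (T% Y) x) (hZ : MDiffAt (T% Z) x) :
    inner ℝ (leviCivita I M Y x (X x)) (Z x) = 1 / 2 * koszul X Y Z x :=
  inner_leviCivitaFun hX hY hZ

/-- The connection `leviCivita` is compatible with the metric. -/
theorem leviCivita_metric {X Y Z : Π x : M, TangentSpace I x} {x : M}
    (hX : MDiffAt (T% X) x) (hY : MDiffAt (T% Y) x) (hZ : MDiffAt (T% Z) x) :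
    mvfderiv I (fun y ↦ inner ℝ (Y y) (Z y)) x (X x) =
      inner ℝ (leviCivita I M Y x (X x)) (Z x) + inner ℝ (Y x) (leviCivita I M Z x (X x)) := by
  rw [inner_leviCivita hX hY hZ, real_inner_comm, inner_leviCivita hX hZ hY]
  simp only [koszul]
  rw [mlieBracket_swap (V := Z) (W := Y)]
  simp only [fun y ↦ real_inner_comm (Z y) (Y y), Pi.neg_apply, inner_neg_left]
  ring

/-- The connection `leviCivita` is torsion-free. -/
theorem leviCivita_torsionFree {X Y : Π x : M, TangentSpace I x} {x : M}
    (hX : MDiffAt (T% X) x) (hY : MDiffAt (T% Y) x) :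
    leviCivita I M Y x (X x) - leviCivita I M X x (Y x) = mlieBracket I X Y x := by
  refine ext_inner_field fun Z hZ ↦ ?_
  rw [inner_sub_left, inner_leviCivita hX hY hZ, inner_leviCivita hY hX hZ]
  simp only [koszul]
  rw [mlieBracket_swap (V := Y) (W := X)]
  simp only [fun y ↦ real_inner_comm (X y) (Y y), Pi.neg_apply, inner_neg_left]
  ring

/-- The curvature `R(X,Y)Z = ∇_X ∇_Y Z - ∇_Y ∇_X Z - ∇_[X,Y] Z` on vector fields. -/
def curvature (X Y Z : Π x : M, TangentSpace I x) (x : M) : TangentSpace I x :=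
  leviCivita I M (fun y ↦ leviCivita I M Z y (Y y)) x (X x)
    - leviCivita I M (fun y ↦ leviCivita I M Z y (X y)) x (Y x)
    - leviCivita I M Z x (mlieBracket I X Y x)

/-- The curvature tensor at a point: `R(u,v)w` is computed with extensions of the three vectors to
vector fields that are smooth near `x` (`FiberBundle.extend`); by tensoriality the choice of the
extensions is immaterial. -/
def curvatureAt (x : M) (u v w : TangentSpace I x) : TangentSpace I x :=
  curvature (extend E u) (extend E v) (extend E w) x

/-- The `*`-Ricci tensor `S*(u,v) = (1/2) trace (w ↦ R(u, φ v) φ w)`, the trace being taken in an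
orthonormal basis of the tangent space. -/
def starRicci (φ : Π x : M, TangentSpace I x →L[ℝ] TangentSpace I x) (x : M)
    (u v : TangentSpace I x) : ℝ :=
  (1 / 2 : ℝ) * ∑ i,
    inner ℝ (curvatureAt x u (φ x v) (φ x (stdOrthonormalBasis ℝ (TangentSpace I x) i)))
      (stdOrthonormalBasis ℝ (TangentSpace I x) i)

/-- `(φ, ξ, η, g)` is an almost contact metric structure, `g` being the Riemannian metric of `M`. -/
structure IsAlmostContactMetric (φ : Π x : M, TangentSpace I x →L[ℝ] TangentSpace I x)
    (ξ : Π x : M, TangentSpace I x) (η : Π x : M, TangentSpace I x →L[ℝ] ℝ) : Prop where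
  smooth_phi : ContMDiff I (I.prod 𝓘(ℝ, E →L[ℝ] E)) ∞
    (fun x ↦ TotalSpace.mk' (E →L[ℝ] E) (E := fun x : M ↦ TangentSpace I x →L[ℝ] TangentSpace I x)
      x (φ x))
  smooth_xi : CMDiff ∞ (T% ξ)
  smooth_eta : ContMDiff I (I.prod 𝓘(ℝ, E →L[ℝ] ℝ)) ∞
    (fun x ↦ TotalSpace.mk' (E →L[ℝ] ℝ) (E := fun x : M ↦ TangentSpace I x →L[ℝ] ℝ) x (η x))
  phi_phi : ∀ (x : M) (u : TangentSpace I x), φ x (φ x u) = -u + η x u • ξ x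
  eta_xi : ∀ x : M, η x (ξ x) = 1
  inner_phi_phi : ∀ (x : M) (u v : TangentSpace I x),
    inner ℝ (φ x u) (φ x v) = inner ℝ u v - η x u * η x v

/-- `(φ, ξ, η, g)` is a Kenmotsu structure: an almost contact metric structure with
`(∇_X φ) Y = g(φ X, Y) ξ - η(Y) φ X`, where `(∇_X φ) Y = ∇_X (φ Y) - φ (∇_X Y)`.
The identity is imposed at each point `x`, for all vector fields `Y` that are smooth near `x`. -/
structure IsKenmotsu (φ : Π x : M, TangentSpace I x →L[ℝ] TangentSpace I x)
    (ξ : Π x : M, TangentSpace I x) (η : Π x : M, TangentSpace I x →L[ℝ] ℝ) : Prop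
    extends IsAlmostContactMetric φ ξ η where
  nabla_phi : ∀ (x : M) (u : TangentSpace I x) (Y : Π x : M, TangentSpace I x),
    CMDiffAt ∞ (T% Y) x →
      leviCivita I M (fun y ↦ φ y (Y y)) x u - φ x (leviCivita I M Y x u) =
        (inner ℝ (φ x u) (Y x) : ℝ) • ξ x - η x (Y x) • φ x u

/-- The Riemannian metric of `M` is a `*`-Ricci soliton with potential vector field `V` and soliton
constant `lam`: `£_V g + 2 S* + 2 lam g = 0`, evaluated at each point `x` on all vector fields
`X`, `Y` that are smooth near `x`. -/
structure IsStarRicciSoliton (φ : Π x : M, TangentSpace I x →L[ℝ] TangentSpace I x)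
    (V : Π x : M, TangentSpace I x) (lam : ℝ) : Prop where
  smooth_potential : CMDiff ∞ (T% V)
  equation : ∀ (x : M) (X Y : Π x : M, TangentSpace I x),
    CMDiffAt ∞ (T% X) x → CMDiffAt ∞ (T% Y) x →
      lieDerivMetric V X Y x + 2 * starRicci φ x (X x) (Y x) + 2 * lam * inner ℝ (X x) (Y x) = 0

end Defs

end StarRicci

end

noncomputable section

set_option linter.unusedSectionVars false

/-! Everything is obtained by Lie differentiation along `ξ`. The Kenmotsu identity gives `∇_X ξ = X
- η(X) ξ`, hence `dη = 0`, `£_ξ φ = 0` and `£_ξ g = 2 (g - η ⊗ η)` (`dirDeriv_xi_ip`). These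
determine `£_ξ ∇ = -2 (g - η ⊗ η) ξ` (`bracket_xi_nabla`), then `£_ξ R` (`bracket_xi_curv`), and
after tracing `£_ξ S* = -2 (g - η ⊗ η)` (`dirDeriv_xi_starRicci`). Moreover `S*(·, ξ) = 0`.

Let `P = £_V g = -2 S* - 2 λ g`. Then `£_ξ P = 4 (1 - λ) (g - η ⊗ η)` and `P(·, ξ) = -2 λ η`. Put `U
= [ξ, V]`. Commuting `£_ξ` with `£_V` on `g` gives, on horizontal fields, `£_U g = 4 (1 - λ) g - 2
P`, and this is annihilated by `£_ξ`, since the two contributions `8 (1 - λ) g` cancel. On the other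
hand `P(·, ξ) = -2 λ η` forces `[ξ, U] = -2 U - 2 λ ξ` (`bracket_xi_bracket_xi`), so commuting `£_ξ`
with `£_U` gives `£_ξ £_U g = -4 λ g` on horizontal fields. Hence `λ g(X, X) = 0` for horizontal `X`
(`smul_ip_self_eq_zero`), and dimension at least three provides a nonzero such vector.

The calculus is done with global smooth fields as a module over the smooth functions, so that tensor
identities become linear algebra over a commutative ring. -/

namespace StarRicci

/-! ### Smooth vector fields as a module over smooth functions; derivations and brackets. -/

section SmoothFields

open Filter Topology

variable {E : Type*} [NormedAddCommGroup E] [NormedSpace ℝ E]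
  {H : Type*} [TopologicalSpace H] {I : ModelWithCorners ℝ E H}
  {M : Type*} [TopologicalSpace M] [ChartedSpace H M] [IsManifold I ∞ M]

variable (I M) in
/-- The smooth vector fields on `M`. -/
abbrev SmoothField := ContMDiffSection I E ∞ (fun x : M ↦ TangentSpace I x)

variable (I M) in
/-- The smooth real functions on `M`. -/
abbrev SmoothFun := ContMDiffMap I 𝓘(ℝ, ℝ) M ℝ ∞

theorem SmoothFun.mdiffAt (f : SmoothFun I M) {x : M} : MDiffAt (fun y ↦ f y) x :=
  f.contMDiff.mdifferentiableAt (by simp)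

theorem SmoothField.mdiffAt (X : SmoothField I M) {x : M} : MDiffAt (T% (fun y ↦ X y)) x :=
  X.contMDiff.mdifferentiableAt (by simp)

namespace SmoothField

instance : SMul (SmoothFun I M) (SmoothField I M) where
  smul f X := ⟨fun x ↦ f x • X x, f.contMDiff.smul_section X.contMDiff⟩

@[simp]
theorem smul_apply (f : SmoothFun I M) (X : SmoothField I M) (x : M) :
    (f • X) x = f x • X x := rfl

@[simp]
theorem add_apply (X Y : SmoothField I M) (x : M) : (X + Y) x = X x + Y x := rfl

@[simp]
theorem sub_apply (X Y : SmoothField I M) (x : M) : (X - Y) x = X x - Y x := rfl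

@[simp]
theorem neg_apply (X : SmoothField I M) (x : M) : (-X) x = -X x := rfl

@[simp]
theorem zero_apply (x : M) : (0 : SmoothField I M) x = 0 := rfl

instance : Module (SmoothFun I M) (SmoothField I M) where
  one_smul X := by ext x; simp
  mul_smul f g X := by ext x; simp [mul_smul]
  smul_zero f := by ext x; simp
  smul_add f X Y := by ext x; simp
  add_smul f g X := by ext x; simp [add_smul]
  zero_smul X := by ext x; simp

@[simp]
theorem sum_apply {ι : Type*} (s : Finset ι) (X : ι → SmoothField I M) (x : M) :
    (∑ i ∈ s, X i) x = ∑ i ∈ s, X i x := by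
  classical
  induction s using Finset.induction_on with
  | empty => simp
  | insert a s ha ih => simp [Finset.sum_insert ha, ih]

/-- The dirDerivative of a smooth function along a smooth vector field. -/
def dirDeriv (X : SmoothField I M) (f : SmoothFun I M) : SmoothFun I M :=
  ⟨fun x ↦ mvfderiv I f x (X x), by
    have h : ContMDiff I 𝓘(ℝ, ℝ).tangent ∞ (fun x ↦ tangentMap I 𝓘(ℝ, ℝ) f ⟨x, X x⟩) :=
      (f.contMDiff.contMDiff_tangentMap (m := ∞) (by simp)).comp X.contMDiff
    exact (contMDiff_snd_tangentBundle_modelSpace ℝ 𝓘(ℝ, ℝ)).comp h⟩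

theorem dirDeriv_apply (X : SmoothField I M) (f : SmoothFun I M) (x : M) :
    dirDeriv X f x = mvfderiv I f x (X x) := rfl

theorem dirDeriv_add (X : SmoothField I M) (f g : SmoothFun I M) :
    dirDeriv X (f + g) = dirDeriv X f + dirDeriv X g := by
  ext x
  simp [dirDeriv_apply, mvfderiv_add f.mdiffAt g.mdiffAt]

theorem dirDeriv_neg (X : SmoothField I M) (f : SmoothFun I M) :
    dirDeriv X (-f) = -dirDeriv X f := by
  ext x
  change mvfderiv I (-f : M → ℝ) x (X x) = -mvfderiv I f x (X x)
  rw [mvfderiv_neg]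
  rfl

theorem dirDeriv_sub (X : SmoothField I M) (f g : SmoothFun I M) :
    dirDeriv X (f - g) = dirDeriv X f - dirDeriv X g := by
  rw [sub_eq_add_neg, dirDeriv_add, dirDeriv_neg, sub_eq_add_neg]

theorem dirDeriv_mul (X : SmoothField I M) (f g : SmoothFun I M) :
    dirDeriv X (f * g) = f * dirDeriv X g + dirDeriv X f * g := by
  ext x
  simp [dirDeriv_apply, mvfderiv_mul f.mdiffAt g.mdiffAt]
  ring

theorem dirDeriv_algebraMap (X : SmoothField I M) (c : ℝ) :
    dirDeriv X (algebraMap ℝ (SmoothFun I M) c) = 0 := by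
  ext x
  change mvfderiv I (fun _ : M ↦ c) x (X x) = 0
  rw [mvfderiv_const]
  rfl

theorem dirDeriv_zero (X : SmoothField I M) : dirDeriv X 0 = 0 := by
  simpa using dirDeriv_algebraMap X 0

theorem dirDeriv_one (X : SmoothField I M) : dirDeriv X 1 = 0 := by
  simpa using dirDeriv_algebraMap X 1

theorem dirDeriv_two (X : SmoothField I M) : dirDeriv X 2 = 0 := by
  rw [← one_add_one_eq_two, dirDeriv_add, dirDeriv_one, add_zero]

theorem add_dirDeriv (X Y : SmoothField I M) (f : SmoothFun I M) :
    dirDeriv (X + Y) f = dirDeriv X f + dirDeriv Y f := by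
  ext x; exact map_add (mvfderiv I _ x) _ _

theorem neg_dirDeriv (X : SmoothField I M) (f : SmoothFun I M) :
    dirDeriv (-X) f = -dirDeriv X f := by
  ext x; exact map_neg (mvfderiv I _ x) _

theorem smul_dirDeriv (f : SmoothFun I M) (X : SmoothField I M) (h : SmoothFun I M) :
    dirDeriv (f • X) h = f * dirDeriv X h := by
  ext x; exact map_smul (mvfderiv I _ x) _ _

theorem dirDeriv_congr {X : SmoothField I M} {f g : SmoothFun I M} {x : M}
    (h : ∀ᶠ y in 𝓝 x, f y = g y) : dirDeriv X f x = dirDeriv X g x := by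
  rw [dirDeriv_apply, dirDeriv_apply, mvfderiv, mvfderiv, Filter.EventuallyEq.mfderiv_eq h,
    h.self_of_nhds]

section Extension

variable [FiniteDimensional ℝ E] [T2Space M]

theorem exists_bump {x : M} {s : Set M} (hs : s ∈ 𝓝 x) :
    ∃ f : SmoothFun I M, (∀ᶠ y in 𝓝 x, f y = 1) ∧ tsupport f ⊆ s := by
  obtain ⟨f, -, hf⟩ := (SmoothBumpFunction.nhds_basis_tsupport (I := I) x).mem_iff.1 hs
  exact ⟨⟨f, f.contMDiff⟩, f.eventuallyEq_one, hf⟩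

theorem exists_eventuallyEq {x : M} {s : Set M} (hs : s ∈ 𝓝 x) {X : Π x : M, TangentSpace I x}
    (hX : ContMDiffOn I I.tangent ∞ (T% X) s) :
    ∃ Y : SmoothField I M, ∀ᶠ y in 𝓝 x, Y y = X y := by
  obtain ⟨u, hus, hu, hxu⟩ := mem_nhds_iff.1 hs
  obtain ⟨f, hf, hfu⟩ := exists_bump (I := I) (hu.mem_nhds hxu)
  refine ⟨⟨(f : M → ℝ) • X,
    ContMDiffOn.smul_section_of_tsupport f.contMDiff.contMDiffOn hu hfu (hX.mono hus)⟩, ?_⟩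
  filter_upwards [hf] with y hy
  change f y • X y = X y
  simp [hy]

theorem exists_eventuallyEq_extend {x : M} (u : TangentSpace I x) :
    ∃ Y : SmoothField I M, ∀ᶠ y in 𝓝 x, Y y = extend E u y := by
  obtain ⟨s, hs, h⟩ := exists_contMDiffOn_extend (I := I) (k := ∞) E u
  exact exists_eventuallyEq hs h

theorem exists_apply_eq {x : M} (u : TangentSpace I x) : ∃ Y : SmoothField I M, Y x = u := by
  obtain ⟨Y, hY⟩ := exists_eventuallyEq_extend u
  exact ⟨Y, by simpa using hY.self_of_nhds⟩

/-- A `C^∞(M)`-linear operation on smooth vector fields is local. -/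
theorem apply_congr_of_eventuallyEq (Φ : SmoothField I M →ₗ[SmoothFun I M] SmoothField I M)
    {X Y : SmoothField I M} {x : M} (h : ∀ᶠ y in 𝓝 x, X y = Y y) : Φ X x = Φ Y x := by
  obtain ⟨f, hf, hfs⟩ := exists_bump (I := I) h
  -- The bump `f` is supported where `X = Y`, so this product vanishes globally, while `f = 1` at
  -- `x`.
  have h0 : f • (X - Y) = 0 := by
    ext y
    by_cases hy : y ∈ tsupport f
    · simp [show X y = Y y from hfs hy]
    · simp [image_eq_zero_of_notMem_tsupport hy]
  have := congr($(map_smul Φ f (X - Y)) x)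
  rw [h0] at this
  simpa [hf.self_of_nhds, sub_eq_zero] using this.symm

end Extension

section Bracket

variable [CompleteSpace E]

/-- The Lie bracket of smooth vector fields. -/
def bracket (X Y : SmoothField I M) : SmoothField I M :=
  ⟨mlieBracket I X Y, fun x ↦ by
    have : IsManifold I (minSmoothness ℝ 2) M :=
      IsManifold.of_le (n := ∞) (by simpa using ENat.LEInfty.out)
    have : IsManifold I (∞ + 1) M := by simpa using ‹IsManifold I ∞ M›
    exact ContMDiffAt.mlieBracket_vectorField (m := ⊤) (n := ⊤) X.contMDiff.contMDiffAt
      Y.contMDiff.contMDiffAt (by simp)⟩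

theorem bracket_apply (X Y : SmoothField I M) (x : M) :
    bracket X Y x = mlieBracket I X Y x := rfl

theorem bracket_swap (X Y : SmoothField I M) : bracket X Y = -bracket Y X := by
  ext x
  exact mlieBracket_swap_apply

theorem bracket_add (X Y Z : SmoothField I M) :
    bracket X (Y + Z) = bracket X Y + bracket X Z := by
  ext x
  exact mlieBracket_add_right Y.mdiffAt Z.mdiffAt

theorem bracket_smul (X : SmoothField I M) (f : SmoothFun I M) (Y : SmoothField I M) :
    bracket X (f • Y) = dirDeriv X f • Y + f • bracket X Y := by
  ext x
  exact mlieBracket_smul_right f.mdiffAt Y.mdiffAt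

theorem bracket_neg (X Y : SmoothField I M) : bracket X (-Y) = -bracket X Y := by
  have h := bracket_add X Y (-Y)
  have h0 := bracket_add X 0 0
  simp only [add_zero, left_eq_add, add_neg_cancel] at h h0
  rw [h0] at h
  exact (neg_eq_of_add_eq_zero_right h.symm).symm

theorem bracket_sub (X Y Z : SmoothField I M) :
    bracket X (Y - Z) = bracket X Y - bracket X Z := by
  rw [sub_eq_add_neg, bracket_add, bracket_neg, sub_eq_add_neg]

theorem add_bracket (X Y Z : SmoothField I M) :
    bracket (X + Y) Z = bracket X Z + bracket Y Z := by
  rw [bracket_swap, bracket_add, bracket_swap X, bracket_swap Y, neg_add]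

theorem smul_bracket (f : SmoothFun I M) (X Y : SmoothField I M) :
    bracket (f • X) Y = f • bracket X Y - dirDeriv Y f • X := by
  rw [bracket_swap, bracket_smul, bracket_swap X]
  module

theorem bracket_bracket (X Y Z : SmoothField I M) :
    bracket X (bracket Y Z) = bracket (bracket X Y) Z + bracket Y (bracket X Z) := by
  have : IsManifold I (minSmoothness ℝ 3) M :=
    IsManifold.of_le (n := ∞) (by simpa using ENat.LEInfty.out)
  have h (W : SmoothField I M) : ContMDiff I I.tangent (minSmoothness ℝ 2) (T% (fun x ↦ W x)) :=
    W.contMDiff.of_le (by simpa using ENat.LEInfty.out)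
  ext x
  exact leibniz_identity_mlieBracket_apply (h X x) (h Y x) (h Z x)

variable [FiniteDimensional ℝ E] [T2Space M]

theorem ext_smul [Nontrivial E] {f g : SmoothFun I M} (h : ∀ Z : SmoothField I M, f • Z = g • Z) :
    f = g := by
  ext x
  obtain ⟨u, hu⟩ := exists_ne (0 : E)
  obtain ⟨Z, hZ⟩ := exists_apply_eq (I := I) (x := x) u
  have := congr($(h Z) x)
  simp only [smul_apply, hZ] at this
  exact smul_left_injective ℝ hu this

/-- Read off from the Jacobi identity for `X`, `Y`, `f • Z`: after the Leibniz rule all other terms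
cancel and the coefficient of the arbitrary field `Z` remains. -/
theorem bracket_dirDeriv [Nontrivial E] (X Y : SmoothField I M) (f : SmoothFun I M) :
    dirDeriv (bracket X Y) f = dirDeriv X (dirDeriv Y f) - dirDeriv Y (dirDeriv X f) := by
  refine ext_smul fun Z ↦ ?_
  have h := bracket_bracket X Y (f • Z)
  simp only [bracket_smul, bracket_add, bracket_bracket X Y Z, smul_add] at h
  linear_combination (norm := module) -h

end Bracket

end SmoothField

end SmoothFields

/-! ### Smooth local orthonormal frames by Gram–Schmidt. -/

section Frames

open Filter Topology InnerProductSpace Module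

variable {E : Type*} [NormedAddCommGroup E] [NormedSpace ℝ E]
  {H : Type*} [TopologicalSpace H] {I : ModelWithCorners ℝ E H}
  {M : Type*} [TopologicalSpace M] [ChartedSpace H M] [IsManifold I ∞ M]
  [RiemannianBundle (fun x : M ↦ TangentSpace I x)]
  [IsContMDiffRiemannianBundle I ∞ E (fun x : M ↦ TangentSpace I x)]

theorem contMDiffOn_inner {u : Set M} {X Y : Π x : M, TangentSpace I x}
    (hX : ContMDiffOn I I.tangent ∞ (T% X) u) (hY : ContMDiffOn I I.tangent ∞ (T% Y) u) :
    ContMDiffOn I 𝓘(ℝ, ℝ) ∞ (fun y ↦ (inner ℝ (X y) (Y y) : ℝ)) u :=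
  ContMDiffOn.inner_bundle (E := fun x : M ↦ TangentSpace I x) (F := E) hX hY

/-- Induction along the Gram–Schmidt recursion; linear independence keeps the denominators nonzero.
-/
theorem contMDiffOn_gramSchmidt {d : ℕ} {u : Set M} {f : Fin d → Π x : M, TangentSpace I x}
    (hf : ∀ i, ContMDiffOn I I.tangent ∞ (T% (f i)) u)
    (hli : ∀ y ∈ u, LinearIndependent ℝ (fun i ↦ f i y)) (i : Fin d) :
    ContMDiffOn I I.tangent ∞ (T% (fun y ↦ gramSchmidt ℝ (fun j ↦ f j y) i)) u := by
  induction i using WellFoundedLT.induction with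
  | ind i ih =>
    have h (y : M) : gramSchmidt ℝ (fun j ↦ f j y) i = f i y - ∑ j ∈ Finset.Iio i,
        (inner ℝ (gramSchmidt ℝ (fun k ↦ f k y) j) (f i y) /
          inner ℝ (gramSchmidt ℝ (fun k ↦ f k y) j) (gramSchmidt ℝ (fun k ↦ f k y) j) : ℝ) •
          gramSchmidt ℝ (fun k ↦ f k y) j := by
      rw [eq_sub_iff_add_eq]
      conv_rhs => rw [gramSchmidt_def'' ℝ (fun j ↦ f j y) i]
      simp
    simp only [h]
    refine (hf i).sub_section (ContMDiffOn.sum_section fun j hj ↦ ?_)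
    have hj' := ih j (Finset.mem_Iio.1 hj)
    refine ContMDiffOn.smul_section ((contMDiffOn_inner hj' (hf i)).div₀
      (contMDiffOn_inner hj' hj') fun y hy ↦ ?_) hj'
    exact inner_self_ne_zero.2 (gramSchmidt_ne_zero j (hli y hy))

theorem contMDiffOn_gramSchmidtNormed {d : ℕ} {u : Set M} {f : Fin d → Π x : M, TangentSpace I x}
    (hf : ∀ i, ContMDiffOn I I.tangent ∞ (T% (f i)) u)
    (hli : ∀ y ∈ u, LinearIndependent ℝ (fun i ↦ f i y)) (i : Fin d) :
    ContMDiffOn I I.tangent ∞ (T% (fun y ↦ gramSchmidtNormed ℝ (fun j ↦ f j y) i)) u := by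
  have hg := contMDiffOn_gramSchmidt hf hli i
  simp only [gramSchmidtNormed, norm_eq_sqrt_real_inner]
  refine ContMDiffOn.smul_section (f := fun y ↦ ((√(inner ℝ (gramSchmidt ℝ (fun j ↦ f j y) i)
    (gramSchmidt ℝ (fun j ↦ f j y) i)))⁻¹ : ℝ)) (fun y hy ↦ ?_) hg
  have h0 : (inner ℝ (gramSchmidt ℝ (fun j ↦ f j y) i) (gramSchmidt ℝ (fun j ↦ f j y) i) : ℝ) ≠ 0 :=
    inner_self_ne_zero.2 (gramSchmidt_ne_zero i (hli y hy))
  have h1 : (inner ℝ (gramSchmidt ℝ (fun j ↦ f j y) i) (gramSchmidt ℝ (fun j ↦ f j y) i) : ℝ) > 0 :=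
    lt_of_le_of_ne real_inner_self_nonneg h0.symm
  have h2 : ContDiffAt ℝ ∞ (fun t : ℝ ↦ (√t)⁻¹)
      (inner ℝ (gramSchmidt ℝ (fun j ↦ f j y) i) (gramSchmidt ℝ (fun j ↦ f j y) i)) :=
    (Real.contDiffAt_sqrt h0).inv (Real.sqrt_ne_zero'.2 h1)
  exact ContMDiffAt.comp_contMDiffWithinAt (g := fun t : ℝ ↦ (√t)⁻¹) y h2.contMDiffAt
    (contMDiffOn_inner hg hg y hy)

variable [FiniteDimensional ℝ E] [T2Space M]

/-- Smooth vector fields which form an orthonormal frame near a given point. -/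
theorem exists_orthonormal_frame (x : M) :
    ∃ e : Fin (finrank ℝ E) → SmoothField I M, ∀ᶠ y in 𝓝 x, Orthonormal ℝ (fun i ↦ e i y) := by
  set t := trivializationAt E (fun x : M ↦ TangentSpace I x) x with ht
  have hfr := t.isLocalFrameOn_localFrame_baseSet I ∞ (finBasis ℝ E)
  have hx : t.baseSet ∈ 𝓝 x := t.open_baseSet.mem_nhds (mem_baseSet_trivializationAt' x)
  have hsm := contMDiffOn_gramSchmidtNormed (I := I) (f := t.localFrame (finBasis ℝ E))
    hfr.contMDiffOn fun y hy ↦ hfr.linearIndependent hy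
  choose e he using fun i ↦ SmoothField.exists_eventuallyEq hx (hsm i)
  refine ⟨e, ?_⟩
  filter_upwards [eventually_all.2 he, hx] with y hy hyt
  simp only [hy]
  exact gramSchmidtNormed_orthonormal (hfr.linearIndependent hyt)

/-- An orthonormal family of the right cardinality in a tangent space, as an orthonormal basis. -/
def orthonormalBasisOf {x : M} {e : Fin (finrank ℝ E) → TangentSpace I x}
    (he : Orthonormal ℝ e) : OrthonormalBasis (Fin (finrank ℝ E)) ℝ (TangentSpace I x) :=
  OrthonormalBasis.mk he (by
    rw [he.linearIndependent.span_eq_top_of_card_eq_finrank' (by simp; rfl)])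

@[simp]
theorem orthonormalBasisOf_apply {x : M} {e : Fin (finrank ℝ E) → TangentSpace I x}
    (he : Orthonormal ℝ e) (i : Fin (finrank ℝ E)) : orthonormalBasisOf he i = e i := by
  simp [orthonormalBasisOf]

end Frames

/-! ### Metric, Levi-Civita connection and curvature on global smooth fields. -/

namespace SmoothField

open Filter Topology Module

variable {E : Type*} [NormedAddCommGroup E] [NormedSpace ℝ E]
  {H : Type*} [TopologicalSpace H] {I : ModelWithCorners ℝ E H}
  {M : Type*} [TopologicalSpace M] [ChartedSpace H M] [IsManifold I ∞ M]
  [RiemannianBundle (fun x : M ↦ TangentSpace I x)]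
  [IsContMDiffRiemannianBundle I ∞ E (fun x : M ↦ TangentSpace I x)]

/-- The inner product of two smooth vector fields. -/
def ip (X Y : SmoothField I M) : SmoothFun I M :=
  ⟨fun x ↦ inner ℝ (X x) (Y x),
    contMDiffOn_univ.1 (contMDiffOn_inner X.contMDiff.contMDiffOn Y.contMDiff.contMDiffOn)⟩

theorem ip_apply (X Y : SmoothField I M) (x : M) : ip X Y x = inner ℝ (X x) (Y x) := rfl

theorem ip_comm (X Y : SmoothField I M) : ip X Y = ip Y X := by
  ext x; exact real_inner_comm (Y x) (X x)

theorem ip_add (X Y Z : SmoothField I M) : ip X (Y + Z) = ip X Y + ip X Z := by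
  ext x; exact inner_add_right (X x) (Y x) (Z x)

theorem ip_smul (f : SmoothFun I M) (X Y : SmoothField I M) : ip X (f • Y) = f * ip X Y := by
  ext x; exact real_inner_smul_right (X x) (Y x) (f x)

theorem ip_neg (X Y : SmoothField I M) : ip X (-Y) = -ip X Y := by
  ext x; exact inner_neg_right (X x) (Y x)

theorem ip_sub (X Y Z : SmoothField I M) : ip X (Y - Z) = ip X Y - ip X Z := by
  ext x; exact inner_sub_right (X x) (Y x) (Z x)

theorem ip_zero (X : SmoothField I M) : ip X 0 = 0 := by
  ext x; exact inner_zero_right (X x)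

theorem add_ip (X Y Z : SmoothField I M) : ip (X + Y) Z = ip X Z + ip Y Z := by
  ext x; exact inner_add_left (X x) (Y x) (Z x)

theorem smul_ip (f : SmoothFun I M) (X Y : SmoothField I M) : ip (f • X) Y = f * ip X Y := by
  ext x; exact real_inner_smul_left (X x) (Y x) (f x)

theorem neg_ip (X Y : SmoothField I M) : ip (-X) Y = -ip X Y := by
  ext x; exact inner_neg_left (X x) (Y x)

theorem sub_ip (X Y Z : SmoothField I M) : ip (X - Y) Z = ip X Z - ip Y Z := by
  ext x; exact inner_sub_left (X x) (Y x) (Z x)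

theorem zero_ip (X : SmoothField I M) : ip 0 X = 0 := by
  ext x; exact inner_zero_left (X x)

theorem ext_ip {X Y : SmoothField I M} (h : ∀ Z, ip X Z = ip Y Z) : X = Y := by
  ext x
  have := congr($(h (X - Y)) x)
  rw [ip_apply, ip_apply, ← sub_eq_zero, ← inner_sub_left] at this
  exact sub_eq_zero.1 (inner_self_eq_zero.1 this)

variable [FiniteDimensional ℝ E] [T2Space M]

instance completeSpace_of_finiteDimensional : CompleteSpace E := FiniteDimensional.complete ℝ E

theorem eq_sum_frame {X : SmoothField I M} {x : M} {e : Fin (finrank ℝ E) → SmoothField I M}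
    (he : Orthonormal ℝ (fun i ↦ e i x)) : X x = (∑ i, ip (e i) X • e i) x := by
  have := (orthonormalBasisOf he).sum_repr' (X x)
  simp only [orthonormalBasisOf_apply] at this
  rw [sum_apply, ← this]
  rfl

theorem ip_eq_sum_frame {x : M} {e : Fin (finrank ℝ E) → SmoothField I M}
    (he : Orthonormal ℝ (fun i ↦ e i x)) (X Y : SmoothField I M) :
    ip X Y x = ∑ j, ip X (e j) x * ip Y (e j) x := by
  have := (orthonormalBasisOf he).sum_inner_mul_inner (X x) (Y x)
  simp only [orthonormalBasisOf_apply] at this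
  rw [ip_apply, ← this]
  refine Finset.sum_congr rfl fun j _ ↦ ?_
  rw [real_inner_comm (Y x)]
  rfl

/-- A `C^∞(M)`-linear operation on smooth vector fields depends on the value at a point only. -/
theorem apply_congr (Φ : SmoothField I M →ₗ[SmoothFun I M] SmoothField I M)
    {X Y : SmoothField I M} {x : M} (h : X x = Y x) : Φ X x = Φ Y x := by
  obtain ⟨e, he⟩ := exists_orthonormal_frame (I := I) x
  -- The frame expansion of `Z` holds only near `x`, which suffices because `Φ` is local.
  have key (Z : SmoothField I M) : Φ Z x = ∑ i, (inner ℝ (e i x) (Z x) : ℝ) • Φ (e i) x := by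
    rw [apply_congr_of_eventuallyEq Φ (he.mono fun y hy ↦ eq_sum_frame (X := Z) hy)]
    simp [map_sum, ip_apply]
  rw [key, key, h]

/-- The Koszul expression of smooth vector fields. -/
def koszulFun (X Y Z : SmoothField I M) : SmoothFun I M :=
  dirDeriv X (ip Y Z) + dirDeriv Y (ip X Z) - dirDeriv Z (ip X Y) + ip (bracket X Y) Z
    - ip (bracket X Z) Y - ip (bracket Y Z) X

/-- In a smooth local orthonormal frame the components are half the Koszul expressions, which are
smooth. -/
theorem contMDiff_leviCivita (X Y : SmoothField I M) :
    ContMDiff I I.tangent ∞ (T% (fun x ↦ leviCivita I M Y x (X x))) := by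
  intro x
  obtain ⟨e, he⟩ := exists_orthonormal_frame (I := I) x
  refine (∑ i, (algebraMap ℝ (SmoothFun I M) (1 / 2) * koszulFun X Y (e i)) • e i :
    SmoothField I M).contMDiff.contMDiffAt.congr_of_eventuallyEq ?_
  filter_upwards [he] with y hy
  congr 1
  rw [← (orthonormalBasisOf hy).sum_repr' (leviCivita I M Y y (X y)), sum_apply]
  refine Finset.sum_congr rfl fun i _ ↦ ?_
  rw [orthonormalBasisOf_apply, real_inner_comm, inner_leviCivita X.mdiffAt Y.mdiffAt (e i).mdiffAt]
  rfl

/-- The Levi-Civita covariant dirDerivative of smooth vector fields. -/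
def nabla (X Y : SmoothField I M) : SmoothField I M :=
  ⟨fun x ↦ leviCivita I M Y x (X x), contMDiff_leviCivita X Y⟩

theorem add_nabla (X Y Z : SmoothField I M) : nabla (X + Y) Z = nabla X Z + nabla Y Z := by
  ext x; exact map_add (leviCivita I M Z x) _ _

theorem sub_nabla (X Y Z : SmoothField I M) : nabla (X - Y) Z = nabla X Z - nabla Y Z := by
  ext x; exact map_sub (leviCivita I M Z x) _ _

theorem smul_nabla (f : SmoothFun I M) (X Y : SmoothField I M) :
    nabla (f • X) Y = f • nabla X Y := by
  ext x; exact map_smul (leviCivita I M Y x) _ _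

theorem nabla_add (X Y Z : SmoothField I M) : nabla X (Y + Z) = nabla X Y + nabla X Z := by
  ext x
  have := (leviCivita I M).isCovariantDerivativeOnUniv.add (x := x) Y.mdiffAt Z.mdiffAt
  exact congr($this (X x))

theorem nabla_smul (X : SmoothField I M) (f : SmoothFun I M) (Y : SmoothField I M) :
    nabla X (f • Y) = f • nabla X Y + dirDeriv X f • Y := by
  ext x
  have := (leviCivita I M).isCovariantDerivativeOnUniv.leibniz (x := x) Y.mdiffAt f.mdiffAt
  exact congr($this (X x))

theorem dirDeriv_ip (X Y Z : SmoothField I M) :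
    dirDeriv X (ip Y Z) = ip (nabla X Y) Z + ip Y (nabla X Z) := by
  ext x
  exact leviCivita_metric X.mdiffAt Y.mdiffAt Z.mdiffAt

theorem nabla_sub_nabla (X Y : SmoothField I M) : nabla X Y - nabla Y X = bracket X Y := by
  ext x
  exact leviCivita_torsionFree X.mdiffAt Y.mdiffAt

/-- The curvature of smooth vector fields. -/
def curv (X Y Z : SmoothField I M) : SmoothField I M :=
  nabla X (nabla Y Z) - nabla Y (nabla X Z) - nabla (bracket X Y) Z

theorem curv_swap (X Y Z : SmoothField I M) : curv X Y Z = -curv Y X Z := by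
  have : nabla (-bracket Y X) Z = -nabla (bracket Y X) Z := by
    ext x; exact map_neg (leviCivita I M Z x) _
  rw [curv, curv, bracket_swap X Y, this]
  abel

theorem curv_add (X Y Z W : SmoothField I M) : curv X Y (Z + W) = curv X Y Z + curv X Y W := by
  simp only [curv, nabla_add]
  abel

theorem add_curv (X Y Z W : SmoothField I M) : curv (X + Y) Z W = curv X Z W + curv Y Z W := by
  simp only [curv, nabla_add, add_nabla, add_bracket]
  abel

theorem smul_curv (f : SmoothFun I M) (X Y Z : SmoothField I M) :
    curv (f • X) Y Z = f • curv X Y Z := by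
  simp only [curv, nabla_smul, smul_nabla, smul_bracket, sub_nabla]
  module

variable [Nontrivial E]

/-- The second derivatives of `f` cancel against `[X,Y] f`. -/
theorem curv_smul (X Y : SmoothField I M) (f : SmoothFun I M) (Z : SmoothField I M) :
    curv X Y (f • Z) = f • curv X Y Z := by
  simp only [curv, nabla_smul, nabla_add, bracket_dirDeriv]
  module

/-- The curvature operator `R(X,Y)` as a `C^∞(M)`-linear map. -/
@[simps]
def curvLin (X Y : SmoothField I M) : SmoothField I M →ₗ[SmoothFun I M] SmoothField I M where
  toFun := curv X Y
  map_add' := curv_add X Y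
  map_smul' f Z := curv_smul X Y f Z

/-- The map `X ↦ R(X,Y)Z` as a `C^∞(M)`-linear map. -/
@[simps]
def curvLinLeft (Y Z : SmoothField I M) : SmoothField I M →ₗ[SmoothFun I M] SmoothField I M where
  toFun X := curv X Y Z
  map_add' X X' := add_curv X X' Y Z
  map_smul' f X := smul_curv f X Y Z

/-- Tensoriality, one slot at a time; the second slot reduces to the first by antisymmetry. -/
theorem curv_congr {X X' Y Y' Z Z' : SmoothField I M} {x : M} (hX : X x = X' x) (hY : Y x = Y' x)
    (hZ : Z x = Z' x) : curv X Y Z x = curv X' Y' Z' x := by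
  have h1 : curv X Y Z x = curv X' Y Z x := apply_congr (curvLinLeft Y Z) hX
  have h2 : curv Y X' Z x = curv Y' X' Z x := apply_congr (curvLinLeft X' Z) hY
  have h3 : curv X' Y' Z x = curv X' Y' Z' x := apply_congr (curvLin X' Y') hZ
  rw [h1, curv_swap, neg_apply, h2, ← neg_apply, ← curv_swap, h3]

theorem curvature_congr {X X' Y Y' Z Z' : Π x : M, TangentSpace I x} {x : M}
    (hX : ∀ᶠ y in 𝓝 x, X y = X' y) (hY : ∀ᶠ y in 𝓝 x, Y y = Y' y) (hZ : ∀ᶠ y in 𝓝 x, Z y = Z' y)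
    (hd : ∀ᶠ y in 𝓝 x, MDiffAt (T% Z) y)
    (hXZ : MDiffAt (T% (fun y ↦ leviCivita I M Z y (X y))) x)
    (hYZ : MDiffAt (T% (fun y ↦ leviCivita I M Z y (Y y))) x) :
    curvature X Y Z x = curvature X' Y' Z' x := by
  have cd {W W' : Π x : M, TangentSpace I x} {y : M} (hW : MDiffAt (T% W) y)
      (h : ∀ᶠ z in 𝓝 y, W z = W' z) : leviCivita I M W y = leviCivita I M W' y := by
    refine (leviCivita I M).isCovariantDerivativeOnUniv.congr_of_eventuallyEq hW ?_ univ_mem h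
    exact hW.congr_of_eventuallyEq (h.mono fun z hz ↦ by simp [hz])
  have hc : ∀ᶠ y in 𝓝 x, leviCivita I M Z y = leviCivita I M Z' y := by
    filter_upwards [hd, eventually_eventually_nhds.2 hZ] with y h1 h2 using cd h1 h2
  have e1 := cd hYZ (hc.and hY |>.mono fun y hy ↦ by simp only [hy.1, hy.2] :
    ∀ᶠ y in 𝓝 x, leviCivita I M Z y (Y y) = leviCivita I M Z' y (Y' y))
  have e2 := cd hXZ (hc.and hX |>.mono fun y hy ↦ by simp only [hy.1, hy.2] :
    ∀ᶠ y in 𝓝 x, leviCivita I M Z y (X y) = leviCivita I M Z' y (X' y))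
  rw [curvature, curvature, e1, e2, hc.self_of_nhds, hX.self_of_nhds, hY.self_of_nhds,
    Filter.EventuallyEq.mlieBracket_vectorField_eq hX hY]

/-- The local extensions in `curvatureAt` are replaced by global fields with the same germs at `x`,
after which only the values at `x` matter. -/
theorem curvatureAt_eq (X Y Z : SmoothField I M) (x : M) :
    curvatureAt x (X x) (Y x) (Z x) = curv X Y Z x := by
  obtain ⟨X', hX⟩ := exists_eventuallyEq_extend (X x)
  obtain ⟨Y', hY⟩ := exists_eventuallyEq_extend (Y x)
  obtain ⟨Z', hZ⟩ := exists_eventuallyEq_extend (Z x)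
  have h := curvature_congr hX hY hZ (Eventually.of_forall fun y ↦ Z'.mdiffAt)
    (nabla X' Z').mdiffAt (nabla Y' Z').mdiffAt
  rw [curvatureAt, ← h, curv_congr (X' := X') (Y' := Y') (Z' := Z')]
  · rfl
  · simpa using hX.self_of_nhds.symm
  · simpa using hY.self_of_nhds.symm
  · simpa using hZ.self_of_nhds.symm

/-- The pointwise linear map induced by a `C^∞(M)`-linear operation on smooth vector fields. -/
def toLinearMapAt (Φ : SmoothField I M →ₗ[SmoothFun I M] SmoothField I M) (x : M) :
    TangentSpace I x →ₗ[ℝ] TangentSpace I x where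
  toFun u := Φ (exists_apply_eq u).choose x
  map_add' u v := by
    rw [← add_apply, ← map_add]
    exact apply_congr Φ (by simp [(exists_apply_eq (I := I) (_ : TangentSpace I x)).choose_spec])
  map_smul' c u := by
    have h : algebraMap ℝ (SmoothFun I M) c x = c := rfl
    rw [RingHom.id_apply]
    conv_rhs => rw [← h, ← smul_apply, ← map_smul]
    refine apply_congr Φ ?_
    rw [smul_apply, h]
    simp [(exists_apply_eq (I := I) (_ : TangentSpace I x)).choose_spec]

theorem toLinearMapAt_apply (Φ : SmoothField I M →ₗ[SmoothFun I M] SmoothField I M)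
    (X : SmoothField I M) (x : M) : toLinearMapAt Φ x (X x) = Φ X x :=
  apply_congr Φ (exists_apply_eq (X x)).choose_spec

end SmoothField

open Filter Topology Module SmoothField

/-! ### Lie derivatives along `ξ` of the metric, `φ`, the connection, the curvature and traces. -/

section KenmotsuAlgebra

variable {E : Type*} [NormedAddCommGroup E] [NormedSpace ℝ E]
  {H : Type*} [TopologicalSpace H] {I : ModelWithCorners ℝ E H}
  {M : Type*} [TopologicalSpace M] [ChartedSpace H M] [IsManifold I ∞ M]
  [RiemannianBundle (fun x : M ↦ TangentSpace I x)]
  [IsContMDiffRiemannianBundle I ∞ E (fun x : M ↦ TangentSpace I x)]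
  [FiniteDimensional ℝ E] [T2Space M]

/-- Replaces division by two in `linear_combination` arguments over the ring of smooth functions. -/
theorem SmoothFun.eq_of_two_mul_eq {f g : SmoothFun I M} (h : 2 * f = 2 * g) : f = g := by
  ext x
  rw [two_mul, two_mul] at h
  have : f x + f x = g x + g x := congr($h x)
  linarith

/-- A Kenmotsu structure in terms of smooth vector fields; the `1`-form `η` is `g(ξ, ·)`. -/
structure KenmotsuFields (phi : SmoothField I M →ₗ[SmoothFun I M] SmoothField I M)
    (xi : SmoothField I M) : Prop where
  ip_xi_xi : ip xi xi = 1
  phi_xi : phi xi = 0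
  phi_phi (X : SmoothField I M) : phi (phi X) = -X + ip xi X • xi
  ip_phi_phi (X Y : SmoothField I M) : ip (phi X) (phi Y) = ip X Y - ip xi X * ip xi Y
  nabla_phi (X Y : SmoothField I M) :
    nabla X (phi Y) - phi (nabla X Y) = ip (phi X) Y • xi - ip xi Y • phi X

namespace KenmotsuFields

variable {phi : SmoothField I M →ₗ[SmoothFun I M] SmoothField I M} {xi : SmoothField I M}

/-- Compare the two ways of computing `φ³ X` from `φ²`. -/
theorem ip_xi_phi (h : KenmotsuFields phi xi) (X : SmoothField I M) : ip xi (phi X) = 0 := by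
  have h1 := h.phi_phi (phi X)
  rw [h.phi_phi X, map_add, map_neg, map_smul, h.phi_xi] at h1
  have h2 : ip xi (phi X) • xi = 0 := by linear_combination (norm := module) -h1
  simpa [ip_smul, h.ip_xi_xi, ip_zero] using congr(ip xi $h2)

theorem ip_phi_left (h : KenmotsuFields phi xi) (X Y : SmoothField I M) :
    ip (phi X) Y = -ip X (phi Y) := by
  have h1 := h.ip_phi_phi X (phi Y)
  rw [h.phi_phi, ip_add, ip_neg, ip_smul, h.ip_xi_phi, ip_comm (phi X) xi, h.ip_xi_phi] at h1
  linear_combination -h1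

/-- The Kenmotsu identity at `Y = ξ` gives `φ (∇_X ξ) = φ X`, which fixes `∇_X ξ` up to its
`ξ`-component; that component vanishes because `ξ` has constant length. -/
theorem nabla_xi (h : KenmotsuFields phi xi) (X : SmoothField I M) :
    nabla X xi = X - ip xi X • xi := by
  have h0 : nabla X 0 = 0 := by simpa using nabla_add X 0 0
  have h1 := h.nabla_phi X xi
  rw [h.phi_xi, h0, h.ip_xi_xi, ip_comm, h.ip_xi_phi] at h1
  have h2 : phi (nabla X xi) = phi X := by linear_combination (norm := module) -h1
  have h3 := dirDeriv_ip X xi xi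
  rw [h.ip_xi_xi, dirDeriv_one, ip_comm (nabla X xi)] at h3
  have h4 : ip xi (nabla X xi) = 0 := SmoothFun.eq_of_two_mul_eq (by linear_combination -h3)
  have h5 := congr(phi $h2)
  rw [h.phi_phi, h.phi_phi, h4] at h5
  linear_combination (norm := module) -h5

theorem bracket_xi (h : KenmotsuFields phi xi) (X : SmoothField I M) :
    bracket xi X = nabla xi X - X + ip xi X • xi := by
  rw [← nabla_sub_nabla, h.nabla_xi]
  module

/-- This is `£_ξ g = 2 (g - η ⊗ η)`. -/
theorem dirDeriv_xi_ip (h : KenmotsuFields phi xi) (X Y : SmoothField I M) :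
    dirDeriv xi (ip X Y) =
      ip (bracket xi X) Y + ip X (bracket xi Y) + 2 * (ip X Y - ip xi X * ip xi Y) := by
  rw [dirDeriv_ip, h.bracket_xi, h.bracket_xi]
  simp only [ip_add, ip_sub, ip_smul, add_ip, sub_ip, smul_ip, ip_comm X xi]
  ring

theorem dirDeriv_ip_xi (h : KenmotsuFields phi xi) (X Y : SmoothField I M) :
    dirDeriv X (ip xi Y) = ip X Y - ip xi X * ip xi Y + ip xi (nabla X Y) := by
  rw [dirDeriv_ip, h.nabla_xi, sub_ip, smul_ip]

/-- This is `dη = 0`, from the symmetry of `∇η = g - η ⊗ η`. -/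
theorem ip_xi_bracket (h : KenmotsuFields phi xi) (X Y : SmoothField I M) :
    ip xi (bracket X Y) = dirDeriv X (ip xi Y) - dirDeriv Y (ip xi X) := by
  rw [h.dirDeriv_ip_xi, h.dirDeriv_ip_xi, ← nabla_sub_nabla, ip_sub, ip_comm Y X]
  ring

/-- This is `£_ξ φ = 0`; since `φ ξ = 0`, the Kenmotsu identity yields `∇_ξ φ = 0`. -/
theorem bracket_xi_phi (h : KenmotsuFields phi xi) (X : SmoothField I M) :
    bracket xi (phi X) = phi (bracket xi X) := by
  have h1 := h.nabla_phi xi X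
  rw [h.phi_xi, zero_ip] at h1
  rw [h.bracket_xi, h.bracket_xi, h.ip_xi_phi, map_add, map_sub, map_smul, h.phi_xi]
  linear_combination (norm := module) h1

/-- The tensor `T = £_ξ ∇` is symmetric because `∇` is torsion-free, and metric compatibility gives
`g(T(X,Y),Z) + g(T(X,Z),Y) = (∇_X £_ξ g)(Y,Z)`. The Koszul combination of three such equations
solves for `T`. -/
theorem bracket_xi_nabla [Nontrivial E] (h : KenmotsuFields phi xi) (X Y : SmoothField I M) :
    bracket xi (nabla X Y) = nabla (bracket xi X) Y + nabla X (bracket xi Y) -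
      (2 * (ip X Y - ip xi X * ip xi Y)) • xi := by
  let T (X Y : SmoothField I M) : SmoothField I M :=
    bracket xi (nabla X Y) - nabla (bracket xi X) Y - nabla X (bracket xi Y)
  have symm (X Y : SmoothField I M) : T X Y = T Y X := by
    have h1 := bracket_bracket xi X Y
    rw [← nabla_sub_nabla X Y, ← nabla_sub_nabla (bracket xi X) Y,
      ← nabla_sub_nabla X (bracket xi Y), bracket_sub] at h1
    simp only [T]
    linear_combination (norm := module) h1
  have skew (X Y Z : SmoothField I M) : ip (T X Y) Z + ip (T X Z) Y =
      -2 * ((ip X Y - ip xi X * ip xi Y) * ip xi Z + (ip X Z - ip xi X * ip xi Z) * ip xi Y) := by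
    have h1 := bracket_dirDeriv xi X (ip Y Z)
    rw [dirDeriv_ip X Y Z, h.dirDeriv_xi_ip, dirDeriv_add, h.dirDeriv_xi_ip, h.dirDeriv_xi_ip, two_mul] at h1
    simp only [dirDeriv_add, dirDeriv_sub, dirDeriv_mul, dirDeriv_two, h.dirDeriv_ip_xi X] at h1
    simp only [dirDeriv_ip] at h1
    simp only [T, sub_ip]
    rw [ip_comm (bracket xi (nabla X Z)) Y, ip_comm (nabla (bracket xi X) Z) Y,
      ip_comm (nabla X (bracket xi Z)) Y]
    linear_combination -h1
  have key : T X Y = -(2 * (ip X Y - ip xi X * ip xi Y)) • xi := by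
    refine ext_ip fun Z ↦ SmoothFun.eq_of_two_mul_eq ?_
    have h1 := skew X Y Z
    have h2 := skew Y X Z
    have h3 := skew Z X Y
    rw [symm Z X, symm Z Y, ip_comm Z X, ip_comm Z Y] at h3
    rw [symm Y X, ip_comm Y X] at h2
    rw [smul_ip]
    linear_combination h1 + h2 - h3
  simp only [T] at key
  linear_combination (norm := module) key

/-- With `T = £_ξ ∇`, one has `(£_ξ R)(X,Y)Z = (∇_X T)(Y,Z) - (∇_Y T)(X,Z)`; the components along
`ξ` cancel. -/
theorem bracket_xi_curv [Nontrivial E] (h : KenmotsuFields phi xi) (X Y Z : SmoothField I M) :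
    bracket xi (curv X Y Z) =
      curv (bracket xi X) Y Z + curv X (bracket xi Y) Z + curv X Y (bracket xi Z)
      - (2 * (ip Y Z - ip xi Y * ip xi Z)) • X + (2 * (ip X Z - ip xi X * ip xi Z)) • Y := by
  have nsub (A B C : SmoothField I M) : nabla A (B - C) = nabla A B - nabla A C :=
    eq_sub_of_add_eq (by rw [← nabla_add, sub_add_cancel])
  simp only [curv, bracket_sub, h.bracket_xi_nabla, bracket_bracket xi X Y, add_nabla, nabla_add,
    nsub, nabla_smul, h.nabla_xi, two_mul, dirDeriv_add, dirDeriv_sub, dirDeriv_mul, h.dirDeriv_ip_xi]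
  simp only [dirDeriv_ip, ← nabla_sub_nabla X Y, sub_ip, ip_sub, ip_comm Y X]
  match_scalars <;> ring

/-- The Lie derivative commutes with the trace, `Ψ` being `£_ξ Φ`. The frame is not invariant under
`ξ`, and its variation is compensated by that of the metric. -/
theorem dirDeriv_xi_trace (h : KenmotsuFields phi xi)
    (Φ Ψ : SmoothField I M →ₗ[SmoothFun I M] SmoothField I M)
    (hΨ : ∀ Z, bracket xi (Φ Z) = Φ (bracket xi Z) + Ψ Z) {x : M}
    {e : Fin (finrank ℝ E) → SmoothField I M} (he : ∀ᶠ y in 𝓝 x, Orthonormal ℝ (fun i ↦ e i y)) :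
    dirDeriv xi (∑ i, ip (Φ (e i)) (e i)) x = (∑ i, ip (Ψ (e i)) (e i)) x := by
  have hx := he.self_of_nhds
  let a (i j) : ℝ := ip (Φ (e i)) (e j) x
  let c (i j) : ℝ := ip (bracket xi (e i)) (e j) x
  let G (i j) : ℝ := ip (e i) (e j) x - ip xi (e i) x * ip xi (e j) x
  -- Differentiate `g(e_i, e_j) = δ_ij`, which is constant near `x`.
  have skew (i j) : c i j + c j i + 2 * G i j = 0 := by
    have h1 := congr($(h.dirDeriv_xi_ip (e i) (e j)) x)
    have h2 : dirDeriv xi (ip (e i) (e j)) x = 0 := by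
      rw [dirDeriv_congr (g := algebraMap ℝ (SmoothFun I M) (if i = j then 1 else 0)),
        dirDeriv_algebraMap]
      · rfl
      · filter_upwards [he] with y hy using orthonormal_iff_ite.1 hy i j
    rw [h2, two_mul, ip_comm (e i) (bracket xi (e j))] at h1
    change 0 = c i j + c j i + (G i j + G i j) at h1
    linarith
  have term (i) : dirDeriv xi (ip (Φ (e i)) (e i)) x = ip (Ψ (e i)) (e i) x +
      ∑ j, (c i j * a j i + a i j * c i j + 2 * (a i j * G j i)) := by
    rw [h.dirDeriv_xi_ip, hΨ, add_ip, two_mul]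
    have h1 : ip (Φ (bracket xi (e i))) (e i) x = ∑ j, c i j * a j i := by
      rw [ip_apply, apply_congr Φ (eq_sum_frame hx), map_sum, SmoothField.sum_apply, sum_inner]
      refine Finset.sum_congr rfl fun j _ ↦ ?_
      rw [map_smul, SmoothField.smul_apply, real_inner_smul_left, ip_comm]
      rfl
    have h2 : ip (Φ (e i)) (bracket xi (e i)) x = ∑ j, a i j * c i j := ip_eq_sum_frame hx _ _
    have h3 : ip (Φ (e i)) (e i) x - ip xi (Φ (e i)) x * ip xi (e i) x = ∑ j, a i j * G j i := by
      rw [ip_eq_sum_frame hx (Φ (e i)) (e i), ip_eq_sum_frame hx xi (Φ (e i)), Finset.sum_mul, ← Finset.sum_sub_distrib]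
      refine Finset.sum_congr rfl fun j _ ↦ ?_
      simp only [a, G, ip_comm (e j) (e i)]
      ring
    rw [Finset.sum_add_distrib, Finset.sum_add_distrib, ← Finset.mul_sum, ← h1, ← h2, ← h3]
    change ip (Φ (bracket xi (e i))) (e i) x + ip (Ψ (e i)) (e i) x
      + ip (Φ (e i)) (bracket xi (e i)) x
      + ((ip (Φ (e i)) (e i) x - ip xi (Φ (e i)) x * ip xi (e i) x)
        + (ip (Φ (e i)) (e i) x - ip xi (Φ (e i)) x * ip xi (e i) x)) = _
    ring
  have dsum : dirDeriv xi (∑ i, ip (Φ (e i)) (e i)) x = ∑ i, dirDeriv xi (ip (Φ (e i)) (e i)) x := by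
    let D : SmoothFun I M →+ ℝ := AddMonoidHom.mk' (fun f ↦ dirDeriv xi f x) fun f g ↦ by
      rw [dirDeriv_add]; rfl
    exact map_sum D _ _
  have vsum : (∑ i, ip (Ψ (e i)) (e i)) x = ∑ i, ip (Ψ (e i)) (e i) x :=
    map_sum (AddMonoidHom.mk' (fun f : SmoothFun I M ↦ f x) fun f g ↦ rfl) _ _
  rw [dsum, vsum, Finset.sum_congr rfl fun i _ ↦ term i, Finset.sum_add_distrib, add_eq_left]
  simp only [Finset.sum_add_distrib]
  -- Exchanging the indices in the first sum makes `a i j` a common factor, multiplied by the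
  -- expression that `skew` annihilates.
  rw [Finset.sum_comm (f := fun i j ↦ c i j * a j i), ← Finset.sum_add_distrib,
    ← Finset.sum_add_distrib]
  refine Finset.sum_eq_zero fun i _ ↦ ?_
  rw [← Finset.sum_add_distrib, ← Finset.sum_add_distrib]
  refine Finset.sum_eq_zero fun j _ ↦ ?_
  have h1 := skew i j
  have h2 : G j i = G i j := by simp only [G, ip_comm (e j) (e i)]; ring
  rw [h2]
  linear_combination a i j * h1

end KenmotsuFields

end KenmotsuAlgebra

open Filter Topology Module SmoothField

/-! ### The double commutator argument. -/

section Soliton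

variable {E : Type*} [NormedAddCommGroup E] [NormedSpace ℝ E]
  {H : Type*} [TopologicalSpace H] {I : ModelWithCorners ℝ E H}
  {M : Type*} [TopologicalSpace M] [ChartedSpace H M] [IsManifold I ∞ M]
  [RiemannianBundle (fun x : M ↦ TangentSpace I x)]
  [IsContMDiffRiemannianBundle I ∞ E (fun x : M ↦ TangentSpace I x)]
  [FiniteDimensional ℝ E] [T2Space M]

/-- The Lie derivative of the metric on smooth vector fields. -/
def lieMetric (V X Y : SmoothField I M) : SmoothFun I M :=
  dirDeriv V (ip X Y) - ip (bracket V X) Y - ip X (bracket V Y)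

namespace KenmotsuFields

variable [Nontrivial E]
  {phi : SmoothField I M →ₗ[SmoothFun I M] SmoothField I M} {xi : SmoothField I M}

theorem ip_xi_bracket_xi (h : KenmotsuFields phi xi) (X : SmoothField I M) :
    ip xi (bracket xi X) = dirDeriv xi (ip xi X) := by
  rw [h.ip_xi_bracket, h.ip_xi_xi, SmoothField.dirDeriv_one, sub_zero]

/-- The commutator of `£_ξ` and `£_W` on the metric, evaluated on horizontal fields. -/
theorem lieMetric_bracket_xi (h : KenmotsuFields phi xi) (W : SmoothField I M)
    {X Y : SmoothField I M} (hX : ip xi X = 0) (hY : ip xi Y = 0) :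
    dirDeriv xi (lieMetric W X Y) - lieMetric W (bracket xi X) Y - lieMetric W X (bracket xi Y) =
      lieMetric (bracket xi W) X Y + 2 * lieMetric W X Y := by
  have h1 := bracket_dirDeriv xi W (ip X Y)
  simp only [lieMetric, dirDeriv_sub, h.dirDeriv_xi_ip, hX, hY, zero_mul, mul_zero, sub_zero,
    bracket_bracket xi W, add_ip, ip_add, dirDeriv_add, dirDeriv_mul, dirDeriv_two] at h1 ⊢
  linear_combination -h1

/-- As `dη = 0`, hypothesis `hB` says `d(η(V)) + g(U, ·) = -2 c η` with `U = [ξ, V]`. At `ξ` it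
gives `η(U) = ξ(η(V)) = -c`. Its Lie derivative along `ξ` then determines `[ξ, U]`, because
`ξ(η(V))` is constant along every field and `£_ξ η = 0`. -/
theorem bracket_xi_bracket_xi (h : KenmotsuFields phi xi) {V : SmoothField I M}
    {c : SmoothFun I M} (hc : ∀ X, dirDeriv X c = 0)
    (hB : ∀ X, lieMetric V X xi = -2 * c * ip xi X) :
    bracket xi (bracket xi V) = -((2 : SmoothFun I M) • bracket xi V + (2 * c) • xi) := by
  set U := bracket xi V with hU
  have hB' (X : SmoothField I M) : dirDeriv X (ip xi V) + ip X U = -2 * c * ip xi X := by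
    rw [← hB, lieMetric, ip_comm (bracket V X) xi, h.ip_xi_bracket, bracket_swap V xi, ← hU,
      ip_neg, ip_comm X xi]
    ring
  have hUc : ip xi U = -c := by
    refine SmoothFun.eq_of_two_mul_eq ?_
    have h1 := hB' xi
    have h2 := h.ip_xi_bracket_xi V
    rw [← hU] at h2
    rw [← h2, h.ip_xi_xi] at h1
    linear_combination h1
  refine ext_ip fun X ↦ ?_
  have h1 := congr(dirDeriv xi $(hB' X))
  have h2 := hB' (bracket xi X)
  have h3 := bracket_dirDeriv xi X (ip xi V)
  rw [← h.ip_xi_bracket_xi V, ← hU, hUc, dirDeriv_neg, hc] at h3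
  rw [h.ip_xi_bracket_xi] at h2
  rw [dirDeriv_add, h.dirDeriv_xi_ip, dirDeriv_mul, dirDeriv_mul, dirDeriv_neg, dirDeriv_two, hc,
    hUc, ip_comm X (bracket xi U), ip_comm X U] at h1
  rw [ip_comm _ U] at h2
  rw [ip_comm _ U] at h1
  rw [neg_ip, add_ip, smul_ip, smul_ip]
  linear_combination h1 - h2 + h3

/-- For horizontal fields, `£_ξ £_U g` is `0` by the first commutator formula and `-4 c g` by the
second. -/
theorem smul_ip_self_eq_zero (h : KenmotsuFields phi xi) {V : SmoothField I M}
    {c : SmoothFun I M} (hc : ∀ X, dirDeriv X c = 0)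
    (hA : ∀ X Y, dirDeriv xi (lieMetric V X Y) - lieMetric V (bracket xi X) Y
      - lieMetric V X (bracket xi Y) = 4 * (1 - c) * (ip X Y - ip xi X * ip xi Y))
    (hB : ∀ X, lieMetric V X xi = -2 * c * ip xi X) {X : SmoothField I M} (hX : ip xi X = 0) :
    c * ip X X = 0 := by
  set U := bracket xi V with hU
  have hPU {Y Z : SmoothField I M} (hY : ip xi Y = 0) (hZ : ip xi Z = 0) :
      lieMetric U Y Z = 4 * (1 - c) * ip Y Z - 2 * lieMetric V Y Z := by
    have h1 := h.lieMetric_bracket_xi V hY hZ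
    rw [hA, hY] at h1
    linear_combination -h1
  -- `£_ξ` preserves horizontality, so `hPU` also applies to `[ξ, X]`.
  have hLX : ip xi (bracket xi X) = 0 := by
    rw [h.ip_xi_bracket_xi, hX, SmoothField.dirDeriv_zero]
  have h1 := h.lieMetric_bracket_xi U hX hX
  rw [hPU hX hX, hPU hLX hX, hPU hX hLX, h.bracket_xi_bracket_xi hc hB] at h1
  have h2 := hA X X
  have h3 := h.dirDeriv_xi_ip X X
  have hconst : dirDeriv xi (4 * (1 - c)) = 0 := by
    rw [show (4 * (1 - c)) = 2 * (2 * (1 - c)) by ring, dirDeriv_mul, dirDeriv_mul, dirDeriv_sub,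
      dirDeriv_two, hc, SmoothField.dirDeriv_one]
    ring
  rw [dirDeriv_sub, dirDeriv_mul, hconst, dirDeriv_mul, dirDeriv_two] at h1
  have h4 : lieMetric (-((2 : SmoothFun I M) • bracket xi V + (2 * c) • xi)) X X =
      -2 * lieMetric U X X - 2 * c * (2 * ip X X) := by
    simp only [lieMetric, neg_dirDeriv, add_dirDeriv, smul_dirDeriv, ← hU]
    rw [bracket_swap (-_) X, bracket_neg, neg_neg, bracket_add, bracket_smul, bracket_smul,
      bracket_swap X U, bracket_swap X xi, dirDeriv_two, dirDeriv_mul, dirDeriv_two, hc]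
    simp only [ip_add, add_ip, ip_smul, smul_ip, ip_neg, neg_ip, h3, hX]
    ring
  rw [h4, hPU hX hX] at h1
  rw [hX] at h2 h3
  refine SmoothFun.eq_of_two_mul_eq (SmoothFun.eq_of_two_mul_eq ?_)
  linear_combination h1 + 2 * h2 - 4 * (1 - c) * h3

end KenmotsuFields

end Soliton

open Filter Topology Module SmoothField

/-! ### From the pointwise structure to smooth fields, and the Lie derivative of `S*`. -/

section StarRicciTensor

variable {E : Type*} [NormedAddCommGroup E] [NormedSpace ℝ E]
  {H : Type*} [TopologicalSpace H] {I : ModelWithCorners ℝ E H}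
  {M : Type*} [TopologicalSpace M] [ChartedSpace H M] [IsManifold I ∞ M]
  [RiemannianBundle (fun x : M ↦ TangentSpace I x)]
  [IsContMDiffRiemannianBundle I ∞ E (fun x : M ↦ TangentSpace I x)]
  [FiniteDimensional ℝ E] [T2Space M]
  {φ : Π x : M, TangentSpace I x →L[ℝ] TangentSpace I x}
  {ξ : Π x : M, TangentSpace I x} {η : Π x : M, TangentSpace I x →L[ℝ] ℝ}

namespace IsAlmostContactMetric

/-- Since `φ² ξ = 0`, `φ ξ` is the multiple `η(φ ξ) ξ`, and applying `η ∘ φ` gives `η(φ ξ)² = 0`. -/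
theorem phi_xi (h : IsAlmostContactMetric φ ξ η) (x : M) : φ x (ξ x) = 0 := by
  have h1 : φ x (φ x (ξ x)) = 0 := by simp [h.phi_phi, h.eta_xi]
  have h2 := h.phi_phi x (φ x (ξ x))
  rw [h1, map_zero] at h2
  have h3 : φ x (ξ x) = η x (φ x (ξ x)) • ξ x := by linear_combination (norm := module) h2
  have h4 := congr(η x (φ x $h3))
  rw [h1, map_zero, map_smul, map_smul, smul_eq_mul] at h4
  have h5 : η x (φ x (ξ x)) = 0 := by simpa using h4.symm
  rw [h3, h5, zero_smul]

theorem eta_apply (h : IsAlmostContactMetric φ ξ η) (x : M) (u : TangentSpace I x) :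
    η x u = inner ℝ (ξ x) u := by
  have h1 := h.inner_phi_phi x (ξ x) u
  rw [h.phi_xi, inner_zero_left, h.eta_xi] at h1
  linarith

/-- The vector field `ξ` as a smooth vector field. -/
def xiField (h : IsAlmostContactMetric φ ξ η) : SmoothField I M := ⟨ξ, h.smooth_xi⟩

/-- The operation of `φ` on smooth vector fields. -/
def phiField (h : IsAlmostContactMetric φ ξ η) :
    SmoothField I M →ₗ[SmoothFun I M] SmoothField I M where
  toFun X := ⟨fun x ↦ φ x (X x), h.smooth_phi.clm_bundle_apply X.contMDiff⟩
  map_add' X Y := by ext x; exact map_add (φ x) _ _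
  map_smul' f X := by ext x; exact map_smul (φ x) _ _

theorem xiField_apply (h : IsAlmostContactMetric φ ξ η) (x : M) : h.xiField x = ξ x := rfl

theorem phiField_apply (h : IsAlmostContactMetric φ ξ η) (X : SmoothField I M) (x : M) :
    h.phiField X x = φ x (X x) := rfl

theorem ip_xiField (h : IsAlmostContactMetric φ ξ η) (X : SmoothField I M) (x : M) :
    ip h.xiField X x = η x (X x) := (h.eta_apply x (X x)).symm

end IsAlmostContactMetric

theorem IsKenmotsu.kenmotsuFields (h : IsKenmotsu φ ξ η) :
    KenmotsuFields h.phiField h.xiField where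
  ip_xi_xi := by
    ext x
    rw [h.ip_xiField]
    exact h.eta_xi x
  phi_xi := by
    ext x
    exact h.phi_xi x
  phi_phi X := by
    ext x
    have := h.phi_phi x (X x)
    rw [← h.ip_xiField] at this
    exact this
  ip_phi_phi X Y := by
    ext x
    have := h.inner_phi_phi x (X x) (Y x)
    rw [← h.ip_xiField, ← h.ip_xiField] at this
    exact this
  nabla_phi X Y := by
    ext x
    have := h.nabla_phi x (X x) Y Y.contMDiff.contMDiffAt
    rw [← h.ip_xiField] at this
    exact this

variable [Nontrivial E]

/-- Basis independence of the trace: the pointwise chosen basis, which need not vary smoothly, gives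
way to a smooth frame that can be differentiated. -/
theorem starRicci_eq_sum (h : IsAlmostContactMetric φ ξ η) {x : M}
    {e : Fin (finrank ℝ E) → SmoothField I M} (he : Orthonormal ℝ (fun i ↦ e i x))
    (X Y : SmoothField I M) :
    starRicci φ x (X x) (Y x) =
      1 / 2 * (∑ i, ip ((curvLin X (h.phiField Y) ∘ₗ h.phiField) (e i)) (e i)) x := by
  set Φ := curvLin X (h.phiField Y) ∘ₗ h.phiField with hΦ
  have key (u : TangentSpace I x) :
      curvatureAt x (X x) (φ x (Y x)) (φ x u) = toLinearMapAt Φ x u := by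
    obtain ⟨Z, rfl⟩ := exists_apply_eq (I := I) u
    rw [toLinearMapAt_apply, ← h.phiField_apply, ← h.phiField_apply, curvatureAt_eq]
    rfl
  have vsum : (∑ i, ip (Φ (e i)) (e i)) x = ∑ i, ip (Φ (e i)) (e i) x :=
    map_sum (AddMonoidHom.mk' (fun f : SmoothFun I M ↦ f x) fun f g ↦ rfl) _ _
  rw [starRicci, vsum]
  simp only [key]
  congr 1
  have h1 := LinearMap.trace_eq_sum_inner (toLinearMapAt Φ x)
    (stdOrthonormalBasis ℝ (TangentSpace I x))
  rw [LinearMap.trace_eq_sum_inner (toLinearMapAt Φ x) (orthonormalBasisOf he)] at h1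
  simp only [orthonormalBasisOf_apply, toLinearMapAt_apply] at h1
  simp only [ip_apply, real_inner_comm] at h1 ⊢
  exact h1.symm

/-- The Lie derivative of the `*`-Ricci tensor along `ξ` is `-2 (g - η ⊗ η)`. -/
theorem dirDeriv_xi_starRicci (h : IsKenmotsu φ ξ η) {X Y : SmoothField I M} {f : SmoothFun I M}
    (hf : ∀ y, f y = starRicci φ y (X y) (Y y)) (x : M) :
    dirDeriv h.xiField f x = starRicci φ x (bracket h.xiField X x) (Y x) +
      starRicci φ x (X x) (bracket h.xiField Y x) -
      2 * (ip X Y - ip h.xiField X * ip h.xiField Y) x := by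
  have hk := h.kenmotsuFields
  set phi := h.phiField with hphi
  set xi := h.xiField with hxi
  obtain ⟨e, he⟩ := exists_orthonormal_frame (I := I) x
  have hx := he.self_of_nhds
  -- `Θ Z` is `(£_ξ R)(X, φ Y) φ Z`; the `η`-terms of `bracket_xi_curv` vanish on the image of `φ`.
  let Θ : SmoothField I M →ₗ[SmoothFun I M] SmoothField I M :=
    { toFun := fun Z ↦ (2 * ip X (phi Z)) • phi Y - (2 * ip (phi Y) (phi Z)) • X
      map_add' := fun Z W ↦ by simp only [map_add, ip_add]; module
      map_smul' := fun c Z ↦ by simp only [map_smul, ip_smul, RingHom.id_apply]; module }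
  let Φ := curvLin X (phi Y) ∘ₗ phi
  let Φ₁ := curvLin (bracket xi X) (phi Y) ∘ₗ phi
  let Φ₂ := curvLin X (phi (bracket xi Y)) ∘ₗ phi
  have hΨ (Z : SmoothField I M) : bracket xi (Φ Z) = Φ (bracket xi Z) + (Φ₁ + Φ₂ + Θ) Z := by
    change bracket xi (curv X (phi Y) (phi Z)) = curv X (phi Y) (phi (bracket xi Z)) +
      (curv (bracket xi X) (phi Y) (phi Z) + curv X (phi (bracket xi Y)) (phi Z) +
      ((2 * ip X (phi Z)) • phi Y - (2 * ip (phi Y) (phi Z)) • X))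
    rw [hk.bracket_xi_curv, hk.bracket_xi_phi, hk.bracket_xi_phi, hk.ip_xi_phi, hk.ip_xi_phi]
    module
  have htr := hk.dirDeriv_xi_trace Φ (Φ₁ + Φ₂ + Θ) hΨ he
  have hsplit : (∑ i, ip ((Φ₁ + Φ₂ + Θ) (e i)) (e i)) =
      (∑ i, ip (Φ₁ (e i)) (e i)) + (∑ i, ip (Φ₂ (e i)) (e i)) + ∑ i, ip (Θ (e i)) (e i) := by
    simp only [LinearMap.add_apply, add_ip, Finset.sum_add_distrib]
  -- Each of the two terms of `Θ` contributes `-2 g(φ X, φ Y)`, by skewness of `φ`.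
  have hΘ : (∑ i, ip (Θ (e i)) (e i)) x = -4 * (ip X Y - ip xi X * ip xi Y) x := by
    have vsum : (∑ i, ip (Θ (e i)) (e i)) x = ∑ i, ip (Θ (e i)) (e i) x :=
      map_sum (AddMonoidHom.mk' (fun f : SmoothFun I M ↦ f x) fun f g ↦ rfl) _ _
    have term (i) : ip (Θ (e i)) (e i) x =
        -2 * (ip (phi X) (e i) x * ip (phi Y) (e i) x) +
          2 * (ip (phi (phi Y)) (e i) x * ip X (e i) x) := by
      have h1 : ip (Θ (e i)) (e i) = ip (phi X) (e i) * -ip (phi Y) (e i)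
          + ip (phi X) (e i) * -ip (phi Y) (e i) + (ip (phi (phi Y)) (e i) * ip X (e i)
          + ip (phi (phi Y)) (e i) * ip X (e i)) := by
        change ip ((2 * ip X (phi (e i))) • phi Y - (2 * ip (phi Y) (phi (e i))) • X) (e i) = _
        rw [sub_ip, smul_ip, smul_ip, hk.ip_phi_left X, hk.ip_phi_left (phi Y)]
        ring
      rw [h1]
      change ip (phi X) (e i) x * -ip (phi Y) (e i) x
          + ip (phi X) (e i) x * -ip (phi Y) (e i) x + (ip (phi (phi Y)) (e i) x * ip X (e i) x
          + ip (phi (phi Y)) (e i) x * ip X (e i) x) = _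
      ring
    rw [vsum, Finset.sum_congr rfl fun i _ ↦ term i, Finset.sum_add_distrib, ← Finset.mul_sum,
      ← Finset.mul_sum, ← ip_eq_sum_frame hx, ← ip_eq_sum_frame hx, hk.ip_phi_left (phi Y),
      ip_comm (phi Y), ← hk.ip_phi_phi]
    change -2 * ip (phi X) (phi Y) x + 2 * -ip (phi X) (phi Y) x = _
    ring
  have hloc : dirDeriv xi f x =
      dirDeriv xi (algebraMap ℝ (SmoothFun I M) (1 / 2) * ∑ i, ip (Φ (e i)) (e i)) x := by
    refine dirDeriv_congr ?_
    filter_upwards [he] with y hy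
    rw [hf, starRicci_eq_sum h.toIsAlmostContactMetric hy]
    rfl
  rw [hloc, dirDeriv_mul, dirDeriv_algebraMap, zero_mul, add_zero]
  change 1 / 2 * dirDeriv xi (∑ i, ip (Φ (e i)) (e i)) x = _
  rw [htr, hsplit]
  change 1 / 2 * ((∑ i, ip (Φ₁ (e i)) (e i)) x + (∑ i, ip (Φ₂ (e i)) (e i)) x +
    (∑ i, ip (Θ (e i)) (e i)) x) = _
  rw [hΘ, starRicci_eq_sum h.toIsAlmostContactMetric hx,
    starRicci_eq_sum h.toIsAlmostContactMetric hx]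
  ring

theorem starRicci_xi_right (h : IsAlmostContactMetric φ ξ η) (X : SmoothField I M) (x : M) :
    starRicci φ x (X x) (ξ x) = 0 := by
  obtain ⟨e, he⟩ := exists_orthonormal_frame (I := I) x
  rw [← h.xiField_apply, starRicci_eq_sum h he.self_of_nhds]
  have h0 : h.phiField h.xiField = 0 := by ext y; exact h.phi_xi y
  have h1 (Z : SmoothField I M) : curv X 0 Z = 0 := by
    rw [curv_swap, ← curvLinLeft_apply, map_zero, neg_zero]
  simp only [h0, LinearMap.comp_apply, curvLin_apply, h1, zero_ip, Finset.sum_const_zero]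
  exact mul_zero _

/-- A `*`-Ricci soliton on a Kenmotsu manifold is steady where `φ` does not vanish. -/
theorem IsStarRicciSoliton.mul_inner_phi_eq_zero {V : Π x : M, TangentSpace I x} {lam : ℝ}
    (hV : IsStarRicciSoliton φ V lam) (h : IsKenmotsu φ ξ η) (x : M) (u : TangentSpace I x) :
    lam * inner ℝ (φ x u) (φ x u) = 0 := by
  have hk := h.kenmotsuFields
  let W : SmoothField I M := ⟨V, hV.smooth_potential⟩
  let c : SmoothFun I M := algebraMap ℝ (SmoothFun I M) lam
  have hc (X : SmoothField I M) : dirDeriv X c = 0 := dirDeriv_algebraMap X lam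
  -- `S*` solved from the soliton equation, which makes its smoothness automatic.
  let S (X Y : SmoothField I M) : SmoothFun I M :=
    algebraMap ℝ (SmoothFun I M) (-(1 / 2)) * (lieMetric W X Y + 2 * (c * ip X Y))
  have two_apply (f : SmoothFun I M) (y : M) : (2 * f) y = 2 * f y := by
    rw [two_mul, two_mul]; rfl
  have hS (X Y : SmoothField I M) (y : M) : S X Y y = starRicci φ y (X y) (Y y) := by
    have h1 : lieMetric W X Y y + 2 * starRicci φ y (X y) (Y y) + 2 * lam * ip X Y y = 0 :=
      hV.equation y X Y X.contMDiff.contMDiffAt Y.contMDiff.contMDiffAt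
    change -(1 / 2) * (lieMetric W X Y y + (2 * (c * ip X Y)) y) = _
    rw [two_apply]
    change -(1 / 2) * (lieMetric W X Y y + 2 * (lam * ip X Y y)) = _
    linarith
  have hP (X Y : SmoothField I M) : lieMetric W X Y = -2 * S X Y - 2 * c * ip X Y := by
    have h2 : (2 : SmoothFun I M) * algebraMap ℝ (SmoothFun I M) (-(1 / 2)) = -1 := by
      rw [← map_ofNat (algebraMap ℝ (SmoothFun I M)) 2, ← map_mul]
      norm_num
    simp only [S]
    linear_combination (lieMetric W X Y + 2 * (c * ip X Y)) * h2
  clear_value S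
  have hLS (X Y : SmoothField I M) : dirDeriv h.xiField (S X Y) =
      S (bracket h.xiField X) Y + S X (bracket h.xiField Y)
        - 2 * (ip X Y - ip h.xiField X * ip h.xiField Y) := by
    ext y
    rw [dirDeriv_xi_starRicci h (hS X Y), ← hS, ← hS, ← two_apply]
    rfl
  -- The horizontal field used is `φ Z`, for a global field `Z` with value `u` at `x`.
  have hfinal := hk.smul_ip_self_eq_zero (V := W) hc (fun X Y ↦ ?_) (fun X ↦ ?_)
    (hk.ip_xi_phi (exists_apply_eq (I := I) u).choose)
  · have := congr($hfinal x)
    change lam * inner ℝ (φ x _) (φ x _) = 0 at this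
    rwa [(exists_apply_eq (I := I) u).choose_spec] at this
  · rw [hP, hP, hP, dirDeriv_sub, neg_mul, dirDeriv_neg, dirDeriv_mul, dirDeriv_mul, dirDeriv_mul,
      dirDeriv_two, hc, hLS, hk.dirDeriv_xi_ip]
    ring
  · have h0 : S X h.xiField = 0 := by
      ext y
      rw [hS]
      exact starRicci_xi_right h.toIsAlmostContactMetric X y
    rw [hP, h0, ip_comm X]
    ring

end StarRicciTensor

end StarRicci

end

/-! ### Conclusion by a dimension count. -/

theorem theorem3p1 (n : ℕ) (hn : 1 ≤ n)
    {M : Type*} [TopologicalSpace M] [T2Space M] [SecondCountableTopology M] [Nonempty M]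
    [ChartedSpace (EuclideanSpace ℝ (Fin (2 * n + 1))) M] [IsManifold (𝓡 (2 * n + 1)) ∞ M]
    [RiemannianBundle (fun x : M ↦ TangentSpace (𝓡 (2 * n + 1)) x)]
    [IsContMDiffRiemannianBundle (𝓡 (2 * n + 1)) ∞ (EuclideanSpace ℝ (Fin (2 * n + 1)))
      (fun x : M ↦ TangentSpace (𝓡 (2 * n + 1)) x)]
    (φ : Π x : M, TangentSpace (𝓡 (2 * n + 1)) x →L[ℝ] TangentSpace (𝓡 (2 * n + 1)) x)
    (ξ : Π x : M, TangentSpace (𝓡 (2 * n + 1)) x)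
    (η : Π x : M, TangentSpace (𝓡 (2 * n + 1)) x →L[ℝ] ℝ)
    (hK : StarRicci.IsKenmotsu φ ξ η)
    (V : Π x : M, TangentSpace (𝓡 (2 * n + 1)) x) (lam : ℝ)
    (hV : StarRicci.IsStarRicciSoliton φ V lam) :
    lam = 0 := by
  obtain ⟨x⟩ := ‹Nonempty M›
  by_contra hlam
  have hφ (u : TangentSpace (𝓡 (2 * n + 1)) x) : φ x u = 0 := by
    have := hV.mul_inner_phi_eq_zero hK x u
    simpa [hlam] using this
  -- If `φ = 0` at `x`, then `φ² = -I + η ⊗ ξ` makes `ξ` span the tangent space, which has dimension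
  -- at least three.
  have hspan (u : TangentSpace (𝓡 (2 * n + 1)) x) : η x u • ξ x = u := by
    have := hK.phi_phi x u
    rw [hφ] at this
    linear_combination (norm := module) -this
  have h1 : Module.finrank ℝ (TangentSpace (𝓡 (2 * n + 1)) x) ≤ 1 :=
    finrank_le_one (ξ x) fun u ↦ ⟨η x u, hspan u⟩
  have h2 : Module.finrank ℝ (TangentSpace (𝓡 (2 * n + 1)) x) = 2 * n + 1 :=
    finrank_euclideanSpace_fin
  omega
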